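/- Let $k$ be an algebraically closed field, $S=k[x_0,\dots,x_r]$ and $\mathbb P^r=\operatorname{Proj} S$. For a closed subscheme $Z\subset\mathbb P^r$ with ideal sheaf $\mathcal I_Z$, let $H^0(\mathcal I_Z(d))$ be the space of forms of degree $d$ vanishing on $Z$, and let $I_Z=\bigoplus_d H^0(\mathcal I_Z(d))\subset S$ be its homogeneous ideal. For $p\ge 1$ we say that $Z$ satisfies $\mathbf N_{2,p}$ if $I_Z$ contains no nonzero linear form, $I_Z$ is generated by quadrics, and in the minimal graded free resolution $$\cdots\to F_t\xrightarrow{\varphi_t}F_{t-1}\to\cdots\xrightarrow{\varphi_1}F_0\to I_Z\to 0$$ the map $\varphi_t$ is represented by a matrix of linear forms for all $1\le t\le p-1$. **Theorem 1.2.** Let $X\subset\mathbb P^r$ be a closed subscheme satisfying $\mathbf N_{2,p}$ with $p\ge 1$, and let $\Lambda\subset\mathbb P^r$ be a linear subspace of dimension $\le p-1$. If $\dim (X\cap\Lambda)\le 0$ (scheme-theoretic intersection; the empty intersection is allowed), then the natural restriction map $$H^0(\mathcal I_X(2))\to H^0(\mathcal I_{X\cap\Lambda,\Lambda}(2))$$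 is surjective, where $H^0(\mathcal I_{X\cap\Lambda,\Lambda}(2))$ is the space of quadratic forms on $\Lambda$ (elements of degree $2$ of $S/I_\Lambda$) vanishing on $X\cap\Lambda$. That is, every quadratic form on $\Lambda$ vanishing on $X\cap\Lambda$ is the restriction of a quadratic form on $\mathbb P^r$ vanishing on $X$. -/

import Mathlib

open AlgebraicGeometry MvPolynomial

universe u

namespace RestrictSyz

section Projective

variable (k : Type u) [Field k] (r : ℕ)

/-- The homogeneous coordinate ring `S = k[x₀, …, x_r]` of `ℙ^r`. -/
abbrev CoordRing : Type u := MvPolynomial (Fin (r + 1)) k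

/-- The standard grading of `S`: `grading k r d` is the space of forms of degree `d`. -/
abbrev grading : ℕ → Submodule k (CoordRing k r) := homogeneousSubmodule (Fin (r + 1)) k

noncomputable instance gradingGraded : GradedAlgebra (grading k r) := MvPolynomial.gradedAlgebra

/-- Projective space `ℙ^r` over `k`, as the scheme `Proj S`. -/
noncomputable abbrev ProjSpace : Scheme.{u} := Proj (grading k r)

/-- A closed subscheme of `ℙ^r`, given by its quasi-coherent ideal sheaf. -/
abbrev ClosedSubscheme : Type u := (ProjSpace k r).IdealSheafData

lemma X_mem_grading (i : Fin (r + 1)) : (X i : CoordRing k r) ∈ grading k r 1 :=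
  (mem_homogeneousSubmodule _ _).2 (isHomogeneous_X k i)

/-- The affine chart `D₊(x_i)` of `ℙ^r`. -/
noncomputable def chart (i : Fin (r + 1)) : (ProjSpace k r).affineOpens :=
  ⟨Proj.basicOpen (grading k r) (X i),
    Proj.isAffineOpen_basicOpen (grading k r) (X i) (X_mem_grading k r i) one_pos⟩

end Projective

section Forms

variable {k : Type u} [Field k] {r : ℕ}

/-- The fraction `f / x_i ^ d` in the degree zero part of `S[1 / x_i]`, for a form `f` of
degree `d`. -/
noncomputable def frac (i : Fin (r + 1)) (d : ℕ) (f : CoordRing k r) (hf : f ∈ grading k r d) :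
    HomogeneousLocalization.Away (grading k r) (X i) :=
  HomogeneousLocalization.Away.mk (grading k r) (X_mem_grading k r i) d f
    (by simpa using hf)

/-- The regular function `f / x_i ^ d` on the chart `D₊(x_i)`, for a form `f` of degree `d`. -/
noncomputable def dehom (i : Fin (r + 1)) (d : ℕ) (f : CoordRing k r) (hf : f ∈ grading k r d) :
    Γ(ProjSpace k r, (chart k r i).1) :=
  (Proj.awayToSection (grading k r) (X i)).hom (frac i d f hf)

lemma dehom_zero (i : Fin (r + 1)) (d : ℕ) : dehom (k := k) i d 0 (zero_mem _) = 0 := by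
  have : frac (k := k) i d 0 (zero_mem _) = 0 := by
    apply HomogeneousLocalization.val_injective
    simp [frac, Localization.mk_zero]
  simp only [dehom, this, map_zero]
  rfl

lemma dehom_add (i : Fin (r + 1)) (d : ℕ) (f g : CoordRing k r) (hf : f ∈ grading k r d)
    (hg : g ∈ grading k r d) :
    dehom i d (f + g) (add_mem hf hg) = dehom i d f hf + dehom i d g hg := by
  have : frac i d (f + g) (add_mem hf hg) = frac i d f hf + frac i d g hg := by
    apply HomogeneousLocalization.val_injective
    simp [frac, Localization.add_mk_self]
  simp only [dehom, this, map_add]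
  rfl

lemma dehom_smul (i : Fin (r + 1)) (d : ℕ) (c : k) (f : CoordRing k r)
    (hf : f ∈ grading k r d) :
    dehom i d (c • f) (Submodule.smul_mem _ c hf) =
      dehom i 0 (C c) ((mem_homogeneousSubmodule _ _).2 (isHomogeneous_C _ c)) *
        dehom i d f hf := by
  have : frac i d (c • f) (Submodule.smul_mem _ c hf) =
      frac i 0 (C c) ((mem_homogeneousSubmodule _ _).2 (isHomogeneous_C _ c)) *
        frac i d f hf := by
    apply HomogeneousLocalization.val_injective
    simp [frac, Localization.mk_mul, MvPolynomial.smul_eq_C_mul]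
  simp only [dehom, this, map_mul]
  rfl

/-- `H⁰(𝓘_Z(d))` inside `H⁰(𝓞(d)) = S_d`: the forms of degree `d` that vanish on the closed
subscheme `Z`, that is, whose dehomogenization on each chart is a section of the ideal sheaf. -/
noncomputable def formsVanishingOn (Z : ClosedSubscheme k r) (d : ℕ) :
    Submodule k (CoordRing k r) where
  carrier := {f | ∃ hf : f ∈ grading k r d, ∀ i, dehom i d f hf ∈ Z.ideal (chart k r i)}
  zero_mem' := ⟨zero_mem _, fun i => by rw [dehom_zero]; exact zero_mem _⟩
  add_mem' := by
    rintro f g ⟨hf, hf'⟩ ⟨hg, hg'⟩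
    exact ⟨add_mem hf hg, fun i => by rw [dehom_add i d f g hf hg]; exact add_mem (hf' i) (hg' i)⟩
  smul_mem' := by
    rintro c f ⟨hf, hf'⟩
    exact ⟨Submodule.smul_mem _ c hf, fun i => by
      rw [dehom_smul i d c f hf]; exact Ideal.mul_mem_left _ _ (hf' i)⟩

/-- The (saturated) homogeneous ideal `I_Z = ⨁_d H⁰(𝓘_Z(d))` of a closed subscheme `Z`. -/
noncomputable def homogIdeal (Z : ClosedSubscheme k r) : Ideal (CoordRing k r) :=
  Ideal.span (⋃ d, (formsVanishingOn Z d : Set (CoordRing k r)))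

/-- The scheme-theoretic intersection: its ideal sheaf is the sum of the two ideal sheaves. -/
noncomputable def inter (Z W : ClosedSubscheme k r) : ClosedSubscheme k r := Z ⊔ W

/-- The dimension of a closed subscheme: the Krull dimension of its underlying space, which is the
closed subset `Z.support` of `ℙ^r` (it is `⊥` if this is empty). -/
noncomputable def dim (Z : ClosedSubscheme k r) : WithBot ℕ∞ :=
  topologicalKrullDim (Z.support : Set (ProjSpace k r))

/-- `Λ` is the linear subspace of `ℙ^r` defined by the vanishing of the vector space `L` of linear
forms: its ideal sheaf is generated by `L`, i.e. on each chart `D₊(x_i)` by the `ℓ / x_i`. -/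
def IsLinearSubspace (Λ : ClosedSubscheme k r) (L : Submodule k (CoordRing k r)) : Prop :=
  L ≤ grading k r 1 ∧
    ∀ i, Λ.ideal (chart k r i) =
      Ideal.span {s | ∃ (l : CoordRing k r) (hl : l ∈ grading k r 1), l ∈ L ∧ s = dehom i 1 l hl}

/-- The dimension `r - dim L` of the linear subspace defined by the space `L` of linear forms
(it is `-1` for the empty subspace). -/
noncomputable def linearDim (L : Submodule k (CoordRing k r)) : ℤ :=
  (r : ℤ) - (Module.finrank k L : ℤ)

/-- The homogeneous coordinate ring `S / I_Λ`; its part of degree `d` is `H⁰(𝓞_Λ(d))` for a linear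
subspace `Λ`. -/
abbrev CoordRingOf (Λ : ClosedSubscheme k r) : Type u := CoordRing k r ⧸ homogIdeal Λ

/-- `H⁰(𝓘_{Z ∩ Λ, Λ}(d))` for a linear subspace `Λ`: the forms of degree `d` on `Λ` (classes modulo
`I_Λ` of forms of degree `d`) that vanish on `Z ∩ Λ`. -/
noncomputable def formsVanishingOnIn (Z Λ : ClosedSubscheme k r) (d : ℕ) :
    Submodule k (CoordRingOf Λ) :=
  (formsVanishingOn (inter Z Λ) d).map (Ideal.Quotient.mkₐ k (homogIdeal Λ)).toLinearMap

lemma formsVanishingOn_mono {Z W : ClosedSubscheme k r} (h : Z ≤ W) (d : ℕ) :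
    formsVanishingOn Z d ≤ formsVanishingOn W d := by
  rintro f ⟨hf, hf'⟩
  exact ⟨hf, fun i => h (chart k r i) (hf' i)⟩

/-- The natural restriction map `H⁰(𝓘_Z(d)) → H⁰(𝓘_{Z ∩ Λ, Λ}(d))`, restricting a form on `ℙ^r`
to `Λ`. -/
noncomputable def restrictForms (Z Λ : ClosedSubscheme k r) (d : ℕ) :
    formsVanishingOn Z d →ₗ[k] formsVanishingOnIn Z Λ d :=
  (Ideal.Quotient.mkₐ k (homogIdeal Λ)).toLinearMap.restrict fun f hf =>
    ⟨f, formsVanishingOn_mono (le_sup_left : Z ≤ Z ⊔ Λ) d hf, rfl⟩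

end Forms

section Syzygies

variable {k : Type u} [Field k] {r : ℕ}

/-- A minimal graded free resolution `⋯ → F₂ → F₁ → F₀ → I → 0` by free `S`-modules of finite rank,
`F_t = ⨁_j S(-deg t j)`, written in matrices: `φ t` is the map `F_{t+1} → F_t`, and `ε` is the row
of the map `F₀ → I`. -/
structure MinimalGradedFreeResolution (I : Ideal (CoordRing k r)) where
  /-- the rank of `F_t` -/
  rank : ℕ → ℕ
  /-- the degrees of the basis elements of `F_t` -/
  deg : ∀ t, Fin (rank t) → ℕ
  /-- the map `F₀ → I` -/
  ε : Fin (rank 0) → CoordRing k r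
  /-- the map `F_{t+1} → F_t` -/
  φ : ∀ t, Matrix (Fin (rank t)) (Fin (rank (t + 1))) (CoordRing k r)
  ε_homogeneous : ∀ j, (ε j).IsHomogeneous (deg 0 j)
  φ_homogeneous : ∀ t i j,
    φ t i j = 0 ∨ ∃ e, deg (t + 1) j = deg t i + e ∧ (φ t i j).IsHomogeneous e
  span_ε : Ideal.span (Set.range ε) = I
  exact_zero : ∀ v : Fin (rank 0) → CoordRing k r,
    ∑ j, v j * ε j = 0 ↔ ∃ w, (φ 0).mulVec w = v
  exact_succ : ∀ (t : ℕ) (v : Fin (rank (t + 1)) → CoordRing k r),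
    (φ t).mulVec v = 0 ↔ ∃ w, (φ (t + 1)).mulVec w = v
  /-- minimality: the entries of all `φ t` lie in the maximal ideal `(x₀, …, x_r)` -/
  minimal : ∀ t i j, constantCoeff (φ t i j) = 0

/-- `Z` is nondegenerate: its homogeneous ideal contains no nonzero linear form. -/
def Nondegenerate (Z : ClosedSubscheme k r) : Prop :=
  ∀ l ∈ homogIdeal Z, l.IsHomogeneous 1 → l = 0

/-- The condition `N_{2,p}` for `p ≥ 1`: `Z` is nondegenerate, `I_Z` is generated by quadrics, and
in the minimal free resolution `⋯ → F₁ → F₀ → I_Z → 0` the maps `F_t → F_{t-1}` are matrices of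
linear forms for `1 ≤ t ≤ p - 1` (with `t = s + 1` below). -/
def SatisfiesN2 (Z : ClosedSubscheme k r) (p : ℕ) : Prop :=
  Nondegenerate Z ∧
  homogIdeal Z = Ideal.span {q | q ∈ homogIdeal Z ∧ q.IsHomogeneous 2} ∧
  ∃ R : MinimalGradedFreeResolution (homogIdeal Z),
    ∀ s, s + 1 ≤ p - 1 → ∀ i j, (R.φ s i j).IsHomogeneous 1

end Syzygies

end RestrictSyz

/-!
The restriction of quadrics is surjective because of a vanishing of `Tor`. Let `I` be the
homogeneous ideal of `X` and `(L)` the ideal of `Λ`, and let `D` be the resolution of `S / I`. A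
quadratic form vanishing on `X ∩ Λ` is a form `f` such that `x_i ^ N f ∈ I + (L)` for all `i`
(`exists_pow_mul_mem_of_mem_formsVanishingOn`; this is quasi-coherence of the ideal sheaf of `X`).
It has to be shown that `f ∈ I + (L)`; the degree two part of such a congruence then produces a
quadric in `I`.

As `X ∩ Λ` is at most zero-dimensional and `k` is infinite, there is a linear form `y` such that all
variables are nilpotent modulo `I + (L, y)` (`exists_linear_form_nilpotent`). By the long exact
sequence for multiplication by `y` on `S / (L)`, the form `y` is a nonzerodivisor on `S / (I + (L))`
in degrees at least two, provided that `Tor₁(S / I, S / (L, y))` vanishes in degrees at least three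
(`exists_sub_mulVec_mem_of_mul`). Since `y ^ N f ∈ I + (L)` for some `N`, this gives the claim.

More generally, `Tor_i(S / I, S / (L'))`, `i ≥ 1`, vanishes in degrees at least `i + 2` if `L'` contains
`L` and `y` and the resolution is linear up to step `i + codim L'` (`torVanishes_of_codim`). This
is clear if `L'` consists of all linear forms, as then the `Tor` is read off from the degrees of the
generators in the minimal resolution. In general one adds a linear form `z` to `L'`: by the long
exact sequence, the vanishing of `Tor_{i+1}` over `S / (L', z)` makes multiplication by `z`
injective on the part of `Tor_i` over `S / (L')` in question; but `z` also acts nilpotently, because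
`I` kills `Tor` (`exists_homotopy_mul`) and a power of `z` is in `I + (L')`. The hypothesis
`dim Λ ≤ p - 1` is what the induction consumes.

Gradings of the free modules are not needed: when the matrices consist of linear forms, a vector of
degree above that of the generators is one whose entries have no constant terms.
-/

namespace RestrictSyz

/-! ### Homogeneous components and ideals of linear forms -/

section GradedPieces

variable {k : Type u} [Field k] {r : ℕ}

lemma coe_decompose_eq_homogeneousComponent (f : CoordRing k r) (i : ℕ) :
    (DirectSum.decompose (grading k r) f i : CoordRing k r) = homogeneousComponent i f :=
  decomposition.decompose'_apply f i

lemma homogeneousComponent_add_mul {m : ℕ} (i : ℕ) {a : CoordRing k r}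
    (ha : a.IsHomogeneous m) (b : CoordRing k r) :
    homogeneousComponent (m + i) (a * b) = a * homogeneousComponent i b := by
  rw [← coe_decompose_eq_homogeneousComponent, ← coe_decompose_eq_homogeneousComponent,
    DirectSum.coe_decompose_mul_add_of_left_mem (grading k r)
      ((mem_homogeneousSubmodule m a).2 ha)]

lemma homogeneousComponent_zero_eq (b : CoordRing k r) :
    homogeneousComponent 0 b = C (constantCoeff b) := by
  rw [homogeneousComponent_zero, constantCoeff_eq]

lemma homogeneousComponent_mul_eq {m : ℕ} {a : CoordRing k r}
    (ha : a.IsHomogeneous m) (b : CoordRing k r) :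
    homogeneousComponent m (a * b) = a * C (constantCoeff b) := by
  rw [← homogeneousComponent_zero_eq, ← homogeneousComponent_add_mul 0 ha, add_zero]

lemma homogeneousComponent_sum_mul {ι : Type*} [Fintype ι] {m : ℕ} {a : ι → CoordRing k r}
    (ha : ∀ j, (a j).IsHomogeneous m) (b : ι → CoordRing k r) :
    homogeneousComponent m (∑ j, a j * b j) = ∑ j, a j * C (constantCoeff (b j)) := by
  rw [map_sum]
  exact Finset.sum_congr rfl fun j _ => homogeneousComponent_mul_eq (ha j) (b j)

lemma isHomogeneous_span_of_forall {s : Set (CoordRing k r)}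
    (hs : ∀ f ∈ s, ∃ d, f.IsHomogeneous d) :
    (Ideal.span s).IsHomogeneous (grading k r) :=
  Ideal.homogeneous_span _ s fun f hf => by
    obtain ⟨d, hd⟩ := hs f hf
    exact ⟨d, (mem_homogeneousSubmodule d f).2 hd⟩

end GradedPieces

section LinearIdeal

variable {k : Type u} [Field k] {r : ℕ}

/-- The ideal generated by a vector space `L` of forms; `L` will consist of linear forms. -/
noncomputable abbrev linearIdeal (L : Submodule k (CoordRing k r)) : Ideal (CoordRing k r) :=
  Ideal.span (L : Set (CoordRing k r))

lemma linearIdeal_isHomogeneous {L : Submodule k (CoordRing k r)} (hL : L ≤ grading k r 1) :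
    (linearIdeal L).IsHomogeneous (grading k r) :=
  isHomogeneous_span_of_forall fun _ hf => ⟨1, (mem_homogeneousSubmodule _ _).1 (hL hf)⟩

/-- A linear endomorphism of the space of linear forms with kernel `L`, namely a projection to a
complement, extends to a ring endomorphism of `S` with kernel the ideal of `L`. -/
lemma exists_algHom_ker_linearIdeal {L : Submodule k (CoordRing k r)} (hL : L ≤ grading k r 1) :
    ∃ ψ : CoordRing k r →ₐ[k] CoordRing k r, (∀ f, ψ f = 0 ↔ f ∈ linearIdeal L) ∧
      ∀ l ∈ grading k r 1, ψ l = 0 → l ∈ L := by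
  obtain ⟨M, hM⟩ := Submodule.exists_isCompl L
  -- `π` is the projection onto `M` along `L`, as an endomorphism of `S`
  let π : CoordRing k r →ₗ[k] CoordRing k r := M.subtype ∘ₗ M.projectionOnto L hM.symm
  have hπ0 : ∀ l, π l = 0 ↔ l ∈ L := fun l => by
    simp [π]
  have hπ1 : ∀ l, l - π l ∈ L := fun l => by
    rw [← hπ0, map_sub, sub_eq_zero]
    exact congrArg M.subtype (Submodule.projectionOnto_apply_left hM.symm _).symm
  let ψ : CoordRing k r →ₐ[k] CoordRing k r := aeval fun i => π (X i)
  have hψ : ∀ l ∈ grading k r 1, ψ l = π l := by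
    intro l hl
    rw [grading, homogeneousSubmodule_one_eq_span_X] at hl
    have : Set.EqOn ψ.toLinearMap π (Set.range X) := by
      rintro _ ⟨i, rfl⟩
      simp [ψ]
    exact LinearMap.eqOn_span this hl
  have hsub : ∀ f, f - ψ f ∈ linearIdeal L := by
    intro f
    induction f using MvPolynomial.induction_on with
    | C a => simp [ψ]
    | add p q hp hq =>
      rw [map_add, add_sub_add_comm]
      exact add_mem hp hq
    | mul_X p i hp =>
      have : p * X i - ψ (p * X i) = (X i) * (p - ψ p) + ψ p * (X i - π (X i)) := by
        simp only [map_mul, ψ, aeval_X]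
        ring
      rw [this]
      exact add_mem (Ideal.mul_mem_left _ _ hp)
        (Ideal.mul_mem_left _ _ (Ideal.subset_span (hπ1 _)))
  refine ⟨ψ, fun f => ⟨fun h => by simpa [h] using hsub f, fun h => ?_⟩, fun l hl h => ?_⟩
  · have : linearIdeal L ≤ RingHom.ker ψ := by
      refine Ideal.span_le.2 fun l hl => ?_
      rw [SetLike.mem_coe, RingHom.mem_ker, hψ l (hL hl), hπ0]
      exact hl
    exact this h
  · rwa [hψ l hl, hπ0] at h

lemma linearIdeal_isPrime {L : Submodule k (CoordRing k r)} (hL : L ≤ grading k r 1) :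
    (linearIdeal L).IsPrime := by
  obtain ⟨ψ, hψ, -⟩ := exists_algHom_ker_linearIdeal hL
  have : linearIdeal L = RingHom.ker ψ := by
    ext f
    rw [RingHom.mem_ker, hψ]
  rw [this]
  exact RingHom.ker_isPrime ψ

lemma mem_of_mem_linearIdeal {L : Submodule k (CoordRing k r)} (hL : L ≤ grading k r 1)
    {l : CoordRing k r} (hl : l ∈ grading k r 1) (h : l ∈ linearIdeal L) : l ∈ L := by
  obtain ⟨ψ, hψ, hψ'⟩ := exists_algHom_ker_linearIdeal hL
  exact hψ' l hl ((hψ l).2 h)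

/-- A linear form outside `L` is a nonzerodivisor modulo the ideal of `L`. -/
lemma mem_linearIdeal_of_mul_mem {L : Submodule k (CoordRing k r)} (hL : L ≤ grading k r 1)
    {y : CoordRing k r} (hy : y ∈ grading k r 1) (hyL : y ∉ L) {f : CoordRing k r}
    (h : y * f ∈ linearIdeal L) : f ∈ linearIdeal L :=
  ((linearIdeal_isPrime hL).mem_or_mem h).resolve_left
    fun h' => hyL (mem_of_mem_linearIdeal hL hy h')

lemma mem_linearIdeal_grading_one_iff {f : CoordRing k r} :
    f ∈ linearIdeal (grading k r 1) ↔ constantCoeff f = 0 := by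
  constructor
  · intro h
    have : linearIdeal (grading k r 1) ≤ RingHom.ker (constantCoeff (R := k)) := by
      refine Ideal.span_le.2 fun l hl => ?_
      rw [SetLike.mem_coe, RingHom.mem_ker, constantCoeff_eq]
      exact ((mem_homogeneousSubmodule _ _).1 hl).coeff_eq_zero (by simp)
    exact this h
  · intro h
    have : ∀ f : CoordRing k r, f - C (constantCoeff f) ∈ linearIdeal (grading k r 1) := by
      intro f
      induction f using MvPolynomial.induction_on with
      | C a => simp
      | add p q hp hq =>
        rw [map_add, map_add, add_sub_add_comm]
        exact add_mem hp hq
      | mul_X p i hp =>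
        simp only [map_mul, constantCoeff_X, mul_zero, map_zero, sub_zero]
        exact Ideal.mul_mem_left _ _ (Ideal.subset_span (X_mem_grading k r i))
    simpa [h] using this f

lemma linearIdeal_grading_one_le {J : Ideal (CoordRing k r)} (h : ∀ i, X i ∈ J) :
    linearIdeal (grading k r 1) ≤ J := by
  refine Ideal.span_le.2 fun l hl => ?_
  rw [grading, homogeneousSubmodule_one_eq_span_X] at hl
  have : Submodule.span k (Set.range X) ≤ J.restrictScalars k := by
    rw [Submodule.span_le]
    rintro _ ⟨i, rfl⟩
    exact h i
  exact this hl

lemma linearIdeal_sup_span_singleton (L : Submodule k (CoordRing k r)) (y : CoordRing k r) :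
    linearIdeal (L ⊔ Submodule.span k {y}) = linearIdeal L ⊔ Ideal.span {y} := by
  apply le_antisymm
  · refine Ideal.span_le.2 fun f hf => ?_
    obtain ⟨a, ha, b, hb, rfl⟩ := Submodule.mem_sup.1 hf
    obtain ⟨c, rfl⟩ := Submodule.mem_span_singleton.1 hb
    rw [smul_eq_C_mul]
    exact add_mem (Ideal.mem_sup_left (Ideal.subset_span ha))
      (Ideal.mem_sup_right (Ideal.mul_mem_left _ _ (Ideal.mem_span_singleton_self y)))
  · refine sup_le (Ideal.span_mono fun f hf => Submodule.mem_sup_left hf) ?_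
    rw [Ideal.span_singleton_le_iff_mem]
    exact Ideal.subset_span (Submodule.mem_sup_right (Submodule.mem_span_singleton_self y))

instance finiteDimensional_grading (d : ℕ) : FiniteDimensional k (grading k r d) :=
  Module.Finite.iff_fg.2 (homogeneousSubmodule_fg _ _ d)

lemma finrank_grading_one : Module.finrank k (grading k r 1) = r + 1 := by
  rw [grading, homogeneousSubmodule_one_eq_span_X, finrank_span_eq_card]
  · simp
  · exact MvPolynomial.linearIndependent_X _ _

lemma finrank_sup_span_singleton_of_le {L : Submodule k (CoordRing k r)} (hL : L ≤ grading k r 1)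
    {y : CoordRing k r} (hyL : y ∉ L) :
    Module.finrank k ↥(L ⊔ Submodule.span k {y}) = Module.finrank k L + 1 := by
  have : FiniteDimensional k L := Submodule.finiteDimensional_of_le hL
  have := Submodule.finrank_sup_add_finrank_inf_eq L (Submodule.span k {y})
  rwa [(Submodule.disjoint_span_singleton_of_notMem hyL).eq_bot, finrank_bot, add_zero,
    finrank_span_singleton (by rintro rfl; exact hyL L.zero_mem)] at this

end LinearIdeal

/-! ### Vanishing of `Tor` for linear resolutions -/

section LinearSyzygies

lemma mulVec_mem {R m n : Type*} [CommRing R] [Fintype n] (M : Matrix m n R) {J : Ideal R}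
    {v : n → R} (hv : ∀ j, v j ∈ J) (i : m) : M.mulVec v i ∈ J := by
  rw [Matrix.mulVec, dotProduct]
  exact Ideal.sum_mem _ fun j _ => Ideal.mul_mem_left _ _ (hv j)

variable {k : Type u} [Field k] {r : ℕ} {n : ℕ → ℕ}
  (D : ∀ t, Matrix (Fin (n t)) (Fin (n (t + 1))) (CoordRing k r))

/-- In an exact sequence of free modules `⋯ → F₂ → F₁ → F₀`, multiplication by an element `a` that
kills the cokernel of `F₁ → F₀` is null-homotopic; `H` is a component of the homotopy, and the
identity is the part of the homotopy relation that survives multiplication by `D t`. -/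
lemma exists_homotopy_mul (hD : ∀ t v, (D t).mulVec v = 0 ↔ ∃ w, (D (t + 1)).mulVec w = v)
    {a : CoordRing k r} (ha : ∀ v, ∃ w, (D 0).mulVec w = a • v) (t : ℕ) :
    ∃ H : Matrix (Fin (n (t + 1))) (Fin (n t)) (CoordRing k r), D t * H * D t = a • D t := by
  induction t with
  | zero =>
    choose h hh using fun j : Fin (n 0) => ha (Pi.single j 1)
    refine ⟨Matrix.of fun i j => h j i, ?_⟩
    have : D 0 * Matrix.of (fun i j => h j i) = a • (1 : Matrix (Fin (n 0)) (Fin (n 0)) _) := by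
      refine Matrix.ext fun i j => ?_
      have := congrFun (hh j) i
      simpa [Matrix.mul_apply, Matrix.mulVec, dotProduct, Matrix.one_apply, Pi.single_apply]
        using this
    rw [this, Matrix.smul_mul, Matrix.one_mul]
  | succ t ih =>
    obtain ⟨H, hH⟩ := ih
    have hDD : D t * D (t + 1) = 0 := by
      refine Matrix.ext fun i j => ?_
      have := congrFun ((hD t _).2 ⟨Pi.single j 1, rfl⟩) i
      simpa [Matrix.mul_apply, Matrix.mulVec, dotProduct, Pi.single_apply] using this
    let E : Matrix (Fin (n (t + 1))) (Fin (n (t + 1))) (CoordRing k r) := a • 1 - H * D t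
    have hE : D t * E = 0 := by
      simp [E, Matrix.mul_sub, ← Matrix.mul_assoc, hH]
    choose h hh using fun j : Fin (n (t + 1)) => (hD t fun i => E i j).1 (by
      refine funext fun i => ?_
      simpa [Matrix.mul_apply, Matrix.mulVec, dotProduct] using congrFun (congrFun hE i) j)
    refine ⟨Matrix.of fun i j => h j i, ?_⟩
    have : D (t + 1) * Matrix.of (fun i j => h j i) = E := by
      refine Matrix.ext fun i j => ?_
      simpa [Matrix.mul_apply, Matrix.mulVec, dotProduct] using congrFun (hh j) i
    rw [this]
    simp [E, Matrix.sub_mul, Matrix.mul_assoc, hDD]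

/-- `Tor_{t+1}(F₀ / im D₀, S / J)` is killed by every `a` that kills `F₀ / im D₀`. -/
lemma exists_mul_sub_mulVec_mem
    (hD : ∀ t v, (D t).mulVec v = 0 ↔ ∃ w, (D (t + 1)).mulVec w = v)
    {a : CoordRing k r} (ha : ∀ v, ∃ w, (D 0).mulVec w = a • v) (J : Ideal (CoordRing k r))
    {t : ℕ} {v : Fin (n (t + 1)) → CoordRing k r} (hv : ∀ i, (D t).mulVec v i ∈ J) :
    ∃ w, ∀ i, a * v i - (D (t + 1)).mulVec w i ∈ J := by
  obtain ⟨H, hH⟩ := exists_homotopy_mul D hD ha t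
  obtain ⟨w, hw⟩ := (hD t (a • v - H.mulVec ((D t).mulVec v))).1 (by
    rw [Matrix.mulVec_sub, Matrix.mulVec_smul, Matrix.mulVec_mulVec, Matrix.mulVec_mulVec, hH,
      Matrix.smul_mulVec, sub_self])
  refine ⟨w, fun i => ?_⟩
  rw [hw]
  simp only [Pi.sub_apply, Pi.smul_apply, smul_eq_mul, sub_sub_cancel]
  exact mulVec_mem _ hv i

variable {D}

/-- If `w` is a boundary modulo `J + (y)`, then its image is `y` times a boundary modulo `J`. -/
lemma exists_mulVec_sub_mul_mem (hDD : ∀ t w, (D t).mulVec ((D (t + 1)).mulVec w) = 0)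
    {J : Ideal (CoordRing k r)} {y : CoordRing k r} {t : ℕ}
    {w : Fin (n (t + 1)) → CoordRing k r} {u : Fin (n (t + 2)) → CoordRing k r}
    (h : ∀ i, w i - (D (t + 1)).mulVec u i ∈ J ⊔ Ideal.span {y}) :
    ∃ z, ∀ i, (D t).mulVec w i - y * (D t).mulVec z i ∈ J := by
  have : ∀ i, ∃ z, w i - (D (t + 1)).mulVec u i - y * z ∈ J := by
    intro i
    obtain ⟨a, ha, b, hb, hab⟩ := Submodule.mem_sup.1 (h i)
    obtain ⟨z, rfl⟩ := Ideal.mem_span_singleton'.1 hb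
    refine ⟨z, ?_⟩
    rw [← hab]
    convert ha using 1
    ring
  choose z hz using this
  refine ⟨z, fun i => ?_⟩
  have : (D t).mulVec w i - y * (D t).mulVec z i =
      (D t).mulVec (w - (D (t + 1)).mulVec u - y • z) i := by
    simp [Matrix.mulVec_sub, Matrix.mulVec_smul, hDD]
  rw [this]
  exact mulVec_mem _ hz i

/-- The part of `Tor_{t+1}(F₀ / im D₀, S / (L))` that vanishes: a cycle of `F_{t+1} ⊗ S / (L)`
with coefficients in the irrelevant ideal is a boundary. If `F_{t+1}` is generated in degree `t + 2`,
these are the cycles of degree at least `t + 3`. -/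
def TorVanishes (D : ∀ t, Matrix (Fin (n t)) (Fin (n (t + 1))) (CoordRing k r))
    (L : Submodule k (CoordRing k r)) (t : ℕ) : Prop :=
  ∀ v : Fin (n (t + 1)) → CoordRing k r, (∀ i, constantCoeff (v i) = 0) →
    (∀ i, (D t).mulVec v i ∈ linearIdeal L) →
    ∃ w, ∀ i, v i - (D (t + 1)).mulVec w i ∈ linearIdeal L

/-- The long exact sequence of `Tor` for multiplication by `y` on `S / (L)`: if the next `Tor` over
`S / (L, y)` vanishes, then `y` can be cancelled. In the graded setting this holds for `v` of
sufficiently large degree; here it suffices that `D t` consists of forms of degree `m + 1` and that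
`v` has no component of degree `m`. -/
lemma exists_sub_mulVec_mem_of_mul (hDD : ∀ t w, (D t).mulVec ((D (t + 1)).mulVec w) = 0)
    {L : Submodule k (CoordRing k r)} (hL : L ≤ grading k r 1) {y : CoordRing k r}
    (hy : y ∈ grading k r 1) (hyL : y ∉ L) {t m : ℕ}
    (hlin : ∀ i j, (D t i j).IsHomogeneous (m + 1))
    (htor : TorVanishes D (L ⊔ Submodule.span k {y}) t)
    {v : Fin (n t) → CoordRing k r} (hv : ∀ i, homogeneousComponent m (v i) = 0)
    {w : Fin (n (t + 1)) → CoordRing k r}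
    (hw : ∀ i, y * v i - (D t).mulVec w i ∈ linearIdeal L) :
    ∃ w, ∀ i, v i - (D t).mulVec w i ∈ linearIdeal L := by
  -- in degree `m + 1` the congruence `y v ≡ D w` says that the constant part of `w` maps to `(L)`
  have hconst : ∀ i, ∑ j, D t i j * C (constantCoeff (w j)) ∈ linearIdeal L := by
    intro i
    have h1 := homogeneousComponent_mem_of_mem (linearIdeal_isHomogeneous hL) (hw i) (m + 1)
    have h2 : homogeneousComponent (m + 1) (y * v i) = 0 := by
      rw [add_comm m 1, homogeneousComponent_add_mul m hy, hv, mul_zero]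
    rw [map_sub, h2, zero_sub, neg_mem_iff] at h1
    rwa [← homogeneousComponent_sum_mul (hlin i) w]
  -- so `w` may be replaced by its part without constant terms
  set w' : Fin (n (t + 1)) → CoordRing k r := fun j => w j - C (constantCoeff (w j)) with hw'_def
  have hw' : ∀ i, y * v i - (D t).mulVec w' i ∈ linearIdeal L := by
    intro i
    have : y * v i - (D t).mulVec w' i = (y * v i - (D t).mulVec w i) +
        ∑ j, D t i j * C (constantCoeff (w j)) := by
      simp only [hw'_def, Matrix.mulVec, dotProduct, mul_sub, Finset.sum_sub_distrib]
      ring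
    rw [this]
    exact add_mem (hw i) (hconst i)
  obtain ⟨u, hu⟩ := htor w' (fun i => by simp [hw'_def]) (fun i => by
    rw [linearIdeal_sup_span_singleton]
    have : (D t).mulVec w' i = -(y * v i - (D t).mulVec w' i) + v i * y := by ring
    rw [this]
    exact add_mem (Ideal.mem_sup_left (neg_mem (hw' i)))
      (Ideal.mem_sup_right (Ideal.mul_mem_left _ _ (Ideal.mem_span_singleton_self y))))
  simp only [linearIdeal_sup_span_singleton] at hu
  obtain ⟨z, hz⟩ := exists_mulVec_sub_mul_mem hDD hu
  refine ⟨z, fun i => mem_linearIdeal_of_mul_mem hL hy hyL ?_⟩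
  have := add_mem (hw' i) (hz i)
  convert this using 1
  ring

/-- Cancellation of `y ^ N`: if `v` is `y`-power torsion modulo boundaries, it is a boundary. -/
lemma exists_sub_mulVec_mem_of_pow_mul
    (hDD : ∀ t w, (D t).mulVec ((D (t + 1)).mulVec w) = 0)
    {L : Submodule k (CoordRing k r)} (hL : L ≤ grading k r 1) {y : CoordRing k r}
    (hy : y ∈ grading k r 1) (hyL : y ∉ L) {t m : ℕ}
    (hlin : ∀ i j, (D t i j).IsHomogeneous (m + 1))
    (htor : TorVanishes D (L ⊔ Submodule.span k {y}) t)
    {v : Fin (n t) → CoordRing k r} (hv : ∀ i, ∀ m' ≤ m, homogeneousComponent m' (v i) = 0)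
    (N : ℕ) {w : Fin (n (t + 1)) → CoordRing k r}
    (hw : ∀ i, y ^ N * v i - (D t).mulVec w i ∈ linearIdeal L) :
    ∃ w, ∀ i, v i - (D t).mulVec w i ∈ linearIdeal L := by
  induction N generalizing v w with
  | zero => exact ⟨w, fun i => by simpa using hw i⟩
  | succ N ih =>
    obtain ⟨w', hw'⟩ := ih (v := y • v) (w := w) (fun i m' hm' => by
      rw [Pi.smul_apply, smul_eq_mul]
      cases m' with
      | zero =>
        have : constantCoeff y = 0 := by
          rw [constantCoeff_eq]
          exact ((mem_homogeneousSubmodule _ _).1 hy).coeff_eq_zero (by simp)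
        rw [homogeneousComponent_zero_eq, map_mul, this, zero_mul, map_zero]
      | succ m' =>
        rw [add_comm m' 1, homogeneousComponent_add_mul m' hy, hv i m' (by omega), mul_zero])
      (fun i => by
        rw [Pi.smul_apply, smul_eq_mul, ← mul_assoc, ← pow_succ]
        exact hw i)
    exact exists_sub_mulVec_mem_of_mul hDD hL hy hyL hlin htor (fun i => hv i m le_rfl) hw'

lemma torVanishes_grading_one (t : ℕ) : TorVanishes D (grading k r 1) t :=
  fun v hv _ => ⟨0, fun i => by
    rw [Matrix.mulVec_zero, Pi.zero_apply, sub_zero]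
    exact mem_linearIdeal_grading_one_iff.2 (hv i)⟩

/-- If the resolution is linear in the steps `1, …, q` and `I + (L)` is primary to the irrelevant
ideal, then the `Tor`s over `S / (L)` vanish up to step `q - codim L`, by descending induction
on `L`: multiplication by a further linear form is both nilpotent and injective on them. -/
lemma torVanishes_of_codim
    (hD : ∀ t v, (D t).mulVec v = 0 ↔ ∃ w, (D (t + 1)).mulVec w = v)
    {I : Ideal (CoordRing k r)} (hI : ∀ a ∈ I, ∀ v, ∃ w, (D 0).mulVec w = a • v) {q : ℕ}
    (hlin : ∀ t, t + 1 ≤ q → ∀ i j, (D (t + 1) i j).IsHomogeneous 1) (c : ℕ) :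
    ∀ (L : Submodule k (CoordRing k r)), L ≤ grading k r 1 → Module.finrank k L + c = r + 1 →
      (∀ l ∈ grading k r 1, ∃ N, l ^ N ∈ I ⊔ linearIdeal L) →
      ∀ t, t + c ≤ q → TorVanishes D L t := by
  have hDD : ∀ t w, (D t).mulVec ((D (t + 1)).mulVec w) = 0 := fun t w => (hD t _).2 ⟨w, rfl⟩
  induction c with
  | zero =>
    intro L hL hc _ t _
    have : L = grading k r 1 :=
      Submodule.eq_of_le_of_finrank_eq hL (by rw [finrank_grading_one]; omega)
    rw [this]
    exact torVanishes_grading_one t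
  | succ c ih =>
    intro L hL hc hnil t htq v hv0 hv
    obtain ⟨y, hy, hyL⟩ : ∃ y ∈ grading k r 1, y ∉ L := by
      by_contra! h
      have h1 : L = grading k r 1 := le_antisymm hL h
      rw [h1, finrank_grading_one] at hc
      omega
    have hle : L ⊔ Submodule.span k {y} ≤ grading k r 1 :=
      sup_le hL ((Submodule.span_singleton_le_iff_mem _ _).2 hy)
    have hrank := finrank_sup_span_singleton_of_le hL hyL
    have htor := ih (L ⊔ Submodule.span k {y}) hle (by omega) (fun l hl => by
      obtain ⟨N, hN⟩ := hnil l hl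
      rw [linearIdeal_sup_span_singleton, ← sup_assoc]
      exact ⟨N, Ideal.mem_sup_left hN⟩) (t + 1) (by omega)
    -- `y ^ N` kills the `Tor` up to elements of `(L)`, because `I` does
    obtain ⟨N, hN⟩ := hnil y hy
    obtain ⟨a, ha, b, hb, hab⟩ := Submodule.mem_sup.1 hN
    obtain ⟨w, hw⟩ := exists_mul_sub_mulVec_mem D hD (hI a ha) (linearIdeal L) hv
    refine exists_sub_mulVec_mem_of_pow_mul hDD hL hy hyL (m := 0) (hlin t (by omega)) htor
      (fun i m' hm' => ?_) N (w := w) fun i => ?_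
    · rw [Nat.le_zero.1 hm', homogeneousComponent_zero_eq, hv0, map_zero]
    · have : y ^ N * v i - (D (t + 1)).mulVec w i =
          (a * v i - (D (t + 1)).mulVec w i) + v i * b := by
        rw [← hab]; ring
      rw [this]
      exact add_mem (hw i) (Ideal.mul_mem_left _ _ hb)

end LinearSyzygies

/-! ### Forms and ideal sheaves on `ℙ^r` -/

section Sheaf

open CategoryTheory

variable {k : Type u} [Field k] {r : ℕ}

lemma val_frac (i : Fin (r + 1)) (d : ℕ) (f : CoordRing k r) (hf : f ∈ grading k r d) :
    (frac i d f hf).val = Localization.mk f ⟨X i ^ d, (Submonoid.mem_powers_iff _ _).2 ⟨d, rfl⟩⟩ :=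
  HomogeneousLocalization.Away.val_mk ..

lemma frac_eq_frac_iff {i : Fin (r + 1)} {d e : ℕ} {f g : CoordRing k r}
    (hf : f ∈ grading k r d) (hg : g ∈ grading k r e) :
    frac i d f hf = frac i e g hg ↔ X i ^ e * f = X i ^ d * g := by
  rw [← HomogeneousLocalization.val_injective _ |>.eq_iff, val_frac, val_frac,
    Localization.mk_eq_mk_iff, Localization.r_iff_exists]
  constructor
  · rintro ⟨⟨_, n, rfl⟩, h⟩
    exact mul_left_cancel₀ (pow_ne_zero n (X_ne_zero i)) h
  · intro h
    exact ⟨1, by simpa using h⟩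

lemma awayToSection_bijective (i : Fin (r + 1)) :
    Function.Bijective (Proj.awayToSection (grading k r) (X i)).hom :=
  ConcreteCategory.bijective_of_isIso
    (Proj.basicOpenIsoAway (grading k r) (X i) (X_mem_grading k r i) one_pos).hom

lemma dehom_eq_dehom_iff {i : Fin (r + 1)} {d e : ℕ} {f g : CoordRing k r}
    (hf : f ∈ grading k r d) (hg : g ∈ grading k r e) :
    dehom i d f hf = dehom i e g hg ↔ X i ^ e * f = X i ^ d * g := by
  rw [← frac_eq_frac_iff hf hg]
  exact (awayToSection_bijective i).1.eq_iff

lemma exists_eq_dehom (i : Fin (r + 1)) (s : Γ(ProjSpace k r, (chart k r i).1)) :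
    ∃ d f, ∃ hf : f ∈ grading k r d, s = dehom i d f hf := by
  obtain ⟨a, rfl⟩ := (awayToSection_bijective i).2 s
  obtain ⟨d, f, hf, rfl⟩ := HomogeneousLocalization.Away.mk_surjective (grading k r)
    (X_mem_grading k r i) a
  exact ⟨d, f, by simpa using hf, rfl⟩

lemma dehom_mul (i : Fin (r + 1)) {d e : ℕ} {f g : CoordRing k r}
    (hf : f ∈ grading k r d) (hg : g ∈ grading k r e) :
    dehom i (d + e) (f * g) (SetLike.mul_mem_graded hf hg) = dehom i d f hf * dehom i e g hg := by
  have : frac i (d + e) (f * g) (SetLike.mul_mem_graded hf hg) =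
      frac i d f hf * frac i e g hg := by
    apply HomogeneousLocalization.val_injective
    rw [HomogeneousLocalization.val_mul, val_frac, val_frac, val_frac, Localization.mk_mul]
    congr 1
    exact Subtype.ext (pow_add _ _ _)
  simp only [dehom, this, map_mul]
  rfl

lemma dehom_pow (i : Fin (r + 1)) {f : CoordRing k r} (hf : f ∈ grading k r 1) (n : ℕ)
    (hf' : f ^ n ∈ grading k r n) : dehom i n (f ^ n) hf' = dehom i 1 f hf ^ n := by
  have : frac i n (f ^ n) hf' = frac i 1 f hf ^ n := by
    apply HomogeneousLocalization.val_injective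
    rw [HomogeneousLocalization.val_pow, val_frac, val_frac, Localization.mk_pow]
    congr 1
    exact Subtype.ext (by simp)
  simp only [dehom, this, map_pow]
  rfl

/-- The value of `f / x_i ^ d` in the local ring at a point of the chart. -/
lemma val_dehom_apply (i : Fin (r + 1)) (d : ℕ) (f : CoordRing k r) (hf : f ∈ grading k r d)
    (p : (chart k r i).1) :
    ((show (ProjectiveSpectrum.Proj.structureSheaf (grading k r)).1.obj
      (Opposite.op (ProjectiveSpectrum.basicOpen (grading k r) (X i))) from
        dehom i d f hf).1 p).val =
      Localization.mk f ⟨X i ^ d, (Submonoid.powers_le.mpr p.2) ⟨d, rfl⟩⟩ := by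
  refine (ProjectiveSpectrum.Proj.awayToSection_apply (grading k r) (X i) _ p).trans ?_
  rw [val_frac, Localization.mk_eq_mk', IsLocalization.map_mk', ← Localization.mk_eq_mk']
  rfl

lemma mem_basicOpen_dehom (i : Fin (r + 1)) (d : ℕ) (f : CoordRing k r) (hf : f ∈ grading k r d)
    (q : ProjSpace k r) (hq : q ∈ (chart k r i).1) :
    q ∈ (ProjSpace k r).basicOpen (dehom i d f hf) ↔ f ∉ q.asHomogeneousIdeal := by
  rw [Scheme.mem_basicOpen _ _ _ hq]
  have h := congr($(ProjectiveSpectrum.Proj.awayToSection_germ (grading k r) (X i) q hq).hom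
    (frac i d f hf))
  change (ConcreteCategory.hom ((ProjSpace k r).presheaf.germ (chart k r i).1 q hq))
    (dehom i d f hf) = _ at h
  rw [h, CommRingCat.hom_comp, RingHom.comp_apply]
  have : IsLocalHom (AlgebraicGeometry.Proj.stalkIso' (grading k r) q).toCommRingCatIso.inv.hom :=
    isLocalHom_of_isIso _
  refine (isUnit_map_iff (AlgebraicGeometry.Proj.stalkIso' (grading k r)
    q).toCommRingCatIso.inv.hom _).trans ?_
  rw [← HomogeneousLocalization.isUnit_iff_isUnit_val]
  have : q.asHomogeneousIdeal.toIdeal.IsPrime := ProjectiveSpectrum.isPrime q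
  have hX : X i ∈ q.asHomogeneousIdeal.toIdeal.primeCompl := hq
  have hv : HomogeneousLocalization.val (HomogeneousLocalization.mapId (grading k r)
      (Submonoid.powers_le.mpr hX) (frac i d f hf)) =
      Localization.mk f ⟨X i ^ d, (Submonoid.powers_le.mpr hX) ⟨d, rfl⟩⟩ := rfl
  rw [CommRingCat.hom_ofHom, hv, Localization.mk_eq_mk', IsLocalization.AtPrime.isUnit_mk'_iff]
  exact Iff.rfl

lemma val_mul_pow_apply {V : (TopologicalSpace.Opens (ProjectiveSpectrum.top (grading k r)))ᵒᵖ}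
    (s t : (ProjectiveSpectrum.Proj.structureSheaf (grading k r)).1.obj V) (d : ℕ) (p : V.unop) :
    ((s * t ^ d).1 p).val = (s.1 p).val * (t.1 p).val ^ d := by
  rw [AlgebraicGeometry.Proj.mul_apply, AlgebraicGeometry.Proj.pow_apply,
    HomogeneousLocalization.val_mul, HomogeneousLocalization.val_pow]

/-- The cocycle relation `(f / x_i ^ d) (x_i / x_j) ^ d = f / x_j ^ d` on `D₊(x_i x_j)`. -/
lemma res_dehom_mul (i j : Fin (r + 1)) (d : ℕ) (f : CoordRing k r) (hf : f ∈ grading k r d)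
    {W : (ProjSpace k r).Opens} (hi : W ≤ (chart k r i).1) (hj : W ≤ (chart k r j).1) :
    ((ProjSpace k r).presheaf.map (homOfLE hi).op).hom (dehom i d f hf) *
      ((ProjSpace k r).presheaf.map (homOfLE hj).op).hom
        (dehom j 1 (X i) (X_mem_grading k r i)) ^ d =
      ((ProjSpace k r).presheaf.map (homOfLE hj).op).hom (dehom j d f hf) := by
  apply Subtype.ext
  funext p
  apply HomogeneousLocalization.val_injective
  have h1 := val_dehom_apply i d f hf ⟨p.1, hi p.2⟩
  have h2 := val_dehom_apply j 1 (X i) (X_mem_grading k r i) ⟨p.1, hj p.2⟩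
  have h3 := val_dehom_apply j d f hf ⟨p.1, hj p.2⟩
  refine Eq.trans ?_ h3.symm
  refine (val_mul_pow_apply _ _ d p).trans ?_
  refine (congrArg₂ (fun a b => a * b ^ d) h1 h2).trans ?_
  simp only [Localization.mk_pow, Localization.mk_mul]
  rw [Localization.mk_eq_mk_iff, Localization.r_iff_exists]
  refine ⟨1, ?_⟩
  simp
  ring

lemma X_pow_mem_grading (i : Fin (r + 1)) (N : ℕ) : (X i ^ N : CoordRing k r) ∈ grading k r N :=
  (mem_homogeneousSubmodule _ _).2 (isHomogeneous_X_pow i N)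

/-- A section over an affine open that belongs to an ideal sheaf on the basic open set of `v` belongs
to it after multiplication by a power of `v`. -/
lemma exists_pow_mul_mem_ideal {Y : Scheme.{u}} (Z : Y.IdealSheafData) {U V : Y.affineOpens}
    (h : V.1 ≤ U.1) (v : Γ(Y, U.1)) (hV : V.1 = Y.basicOpen v) {s : Γ(Y, U.1)}
    (hs : (Y.presheaf.map (homOfLE h).op).hom s ∈ Z.ideal V) : ∃ n, v ^ n * s ∈ Z.ideal U := by
  rw [← Z.map_ideal' (homOfLE h).op] at hs
  let _ : Algebra Γ(Y, U.1) Γ(Y, V.1) := (Y.presheaf.map (homOfLE h).op).hom.toAlgebra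
  have : IsLocalization.Away v Γ(Y, V.1) :=
    U.2.isLocalization_of_eq_basicOpen v (homOfLE h) hV
  obtain ⟨⟨⟨a, ha⟩, ⟨_, n, rfl⟩⟩, hx⟩ :=
    (IsLocalization.mem_map_algebraMap_iff (Submonoid.powers v) Γ(Y, V.1)).1 hs
  change algebraMap Γ(Y, U.1) Γ(Y, V.1) s * _ = _ at hx
  rw [← map_mul] at hx
  obtain ⟨⟨_, m, rfl⟩, hm⟩ := (IsLocalization.eq_iff_exists (Submonoid.powers v) Γ(Y, V.1)).1 hx
  refine ⟨m + n, ?_⟩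
  have hm' : v ^ m * (s * v ^ n) = v ^ m * a := hm
  rw [pow_add, mul_assoc, mul_comm (v ^ n), hm']
  exact Ideal.mul_mem_left _ _ ha

/-- A section of an ideal sheaf on the chart `D₊(x_i)` extends to the chart `D₊(x_j)` after
multiplication by a power of `x_i`. -/
lemma exists_pow_dehom_mem (Z : ClosedSubscheme k r) {i : Fin (r + 1)} {d : ℕ}
    {g : CoordRing k r} (hg : g ∈ grading k r d) (h : dehom i d g hg ∈ Z.ideal (chart k r i))
    (j : Fin (r + 1)) :
    ∃ N₀, ∀ N ≥ N₀, dehom j (N + d) (X i ^ N * g)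
      (SetLike.mul_mem_graded (X_pow_mem_grading i N) hg) ∈ Z.ideal (chart k r j) := by
  obtain ⟨W, hW⟩ : ∃ W : (ProjSpace k r).affineOpens,
      W.1 = (chart k r i).1 ⊓ (chart k r j).1 :=
    ⟨⟨Proj.basicOpen (grading k r) (X i * X j),
      Proj.isAffineOpen_basicOpen (grading k r) (X i * X j)
        (SetLike.mul_mem_graded (X_mem_grading k r i) (X_mem_grading k r j)) (by norm_num)⟩,
      Proj.basicOpen_mul ..⟩
  have hi : W.1 ≤ (chart k r i).1 := hW.trans_le inf_le_left
  have hj : W.1 ≤ (chart k r j).1 := hW.trans_le inf_le_right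
  have hWu : W.1 = (ProjSpace k r).basicOpen (dehom j 1 (X i) (X_mem_grading k r i)) := by
    rw [hW]
    ext q
    constructor
    · rintro ⟨hqi, hqj⟩
      exact (mem_basicOpen_dehom j 1 _ _ q hqj).2 hqi
    · intro hq
      have hqj := (ProjSpace k r).basicOpen_le _ hq
      exact ⟨(mem_basicOpen_dehom j 1 _ _ q hqj).1 hq, hqj⟩
  obtain ⟨n, hn⟩ := exists_pow_mul_mem_ideal Z hj _ hWu (s := dehom j d g hg) (by
    rw [← res_dehom_mul i j d g hg hi hj]
    refine Ideal.mul_mem_right _ _ ?_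
    rw [← Z.map_ideal' (homOfLE hi).op]
    exact Ideal.mem_map_of_mem _ h)
  refine ⟨n, fun N hN => ?_⟩
  rw [dehom_mul j (X_pow_mem_grading i N) hg, dehom_pow j (X_mem_grading k r i),
    ← Nat.sub_add_cancel hN, pow_add, mul_assoc]
  exact Ideal.mul_mem_left _ _ hn

/-- Every section of an ideal sheaf on the chart `D₊(x_i)` is the dehomogenization of a form that
vanishes on the closed subscheme. -/
lemma exists_eq_dehom_of_mem (Z : ClosedSubscheme k r) {i : Fin (r + 1)}
    {s : Γ(ProjSpace k r, (chart k r i).1)} (hs : s ∈ Z.ideal (chart k r i)) :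
    ∃ d f, ∃ hf : f ∈ grading k r d, f ∈ formsVanishingOn Z d ∧ s = dehom i d f hf := by
  obtain ⟨d, g, hg, rfl⟩ := exists_eq_dehom i s
  choose N hN using exists_pow_dehom_mem Z hg hs
  refine ⟨Finset.univ.sup N + d, X i ^ Finset.univ.sup N * g,
    SetLike.mul_mem_graded (X_pow_mem_grading i _) hg,
    ⟨SetLike.mul_mem_graded (X_pow_mem_grading i _) hg, fun j =>
      hN j _ (Finset.le_sup (Finset.mem_univ j))⟩, ?_⟩
  rw [dehom_eq_dehom_iff, ← mul_assoc, ← pow_add, add_comm d]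

/-- Forms of degree `d` in the homogeneous ideal of `Z` vanish on `Z`. -/
lemma mem_formsVanishingOn_of_mem_homogIdeal {Z : ClosedSubscheme k r} {d : ℕ}
    {f : CoordRing k r} (hf : f ∈ homogIdeal Z) (hd : f ∈ grading k r d) :
    f ∈ formsVanishingOn Z d := by
  have key : ∀ f ∈ homogIdeal Z, ∀ e, homogeneousComponent e f ∈ formsVanishingOn Z e := by
    intro f hf
    refine Submodule.span_induction ?_ ?_ ?_ ?_ hf
    · intro f hf e
      obtain ⟨d, hd⟩ := Set.mem_iUnion.1 hf
      rw [homogeneousComponent_of_mem hd.1]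
      split_ifs with h
      · rwa [h]
      · exact zero_mem _
    · intro e
      rw [map_zero]
      exact zero_mem _
    · intro f g _ _ hf hg e
      rw [map_add]
      exact add_mem (hf e) (hg e)
    · intro a f _ hf
      rw [smul_eq_mul]
      -- it suffices to multiply by constants and by variables
      induction a using MvPolynomial.induction_on with
      | C c =>
        intro e
        rw [homogeneousComponent_C_mul, ← smul_eq_C_mul]
        exact Submodule.smul_mem _ _ (hf e)
      | add p q hp hq =>
        intro e
        rw [add_mul, map_add]
        exact add_mem (hp e) (hq e)
      | mul_X p i hp =>
        intro e
        rw [mul_assoc, mul_comm (X i), ← mul_assoc, mul_comm]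
        cases e with
        | zero =>
          rw [homogeneousComponent_zero_eq, map_mul, constantCoeff_X, zero_mul, map_zero]
          exact zero_mem _
        | succ e =>
          obtain ⟨h1, h2⟩ := hp e
          rw [add_comm e 1, homogeneousComponent_add_mul e (isHomogeneous_X k i)]
          refine ⟨SetLike.mul_mem_graded (X_mem_grading k r i) h1, fun j => ?_⟩
          rw [dehom_mul j (X_mem_grading k r i) h1]
          exact Ideal.mul_mem_left _ _ (h2 j)
  have := key f hf d
  rwa [homogeneousComponent_eq_self ((mem_homogeneousSubmodule _ _).1 hd)] at this

lemma homogIdeal_isHomogeneous (Z : ClosedSubscheme k r) :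
    (homogIdeal Z).IsHomogeneous (grading k r) :=
  isHomogeneous_span_of_forall fun f hf => by
    obtain ⟨d, hd⟩ := Set.mem_iUnion.1 hf
    exact ⟨d, (mem_homogeneousSubmodule _ _).1 hd.1⟩

lemma X_pow_mul_add_mem_grading (i : Fin (r + 1)) {d e : ℕ} {f g : CoordRing k r}
    (hf : f ∈ grading k r d) (hg : g ∈ grading k r e) :
    X i ^ e * f + X i ^ d * g ∈ grading k r (d + e) := by
  refine add_mem ?_ (SetLike.mul_mem_graded (X_pow_mem_grading i d) hg)
  rw [add_comm d e]
  exact SetLike.mul_mem_graded (X_pow_mem_grading i e) hf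

lemma dehom_add_dehom (i : Fin (r + 1)) {d e : ℕ} {f g : CoordRing k r}
    (hf : f ∈ grading k r d) (hg : g ∈ grading k r e) :
    dehom i d f hf + dehom i e g hg = dehom i (d + e) (X i ^ e * f + X i ^ d * g)
      (X_pow_mul_add_mem_grading i hf hg) := by
  have h2 : X i ^ d * g ∈ grading k r (d + e) := SetLike.mul_mem_graded (X_pow_mem_grading i d) hg
  have h1 : X i ^ e * f ∈ grading k r (d + e) := by
    rw [add_comm d e]
    exact SetLike.mul_mem_graded (X_pow_mem_grading i e) hf
  rw [dehom_add i (d + e) _ _ h1 h2]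
  congr 1
  · rw [dehom_eq_dehom_iff, ← mul_assoc, ← pow_add]
  · rw [dehom_eq_dehom_iff, ← mul_assoc, ← pow_add, add_comm d e]

lemma linearIdeal_le_homogIdeal {Λ : ClosedSubscheme k r} {L : Submodule k (CoordRing k r)}
    (hΛ : IsLinearSubspace Λ L) : linearIdeal L ≤ homogIdeal Λ := by
  refine Ideal.span_mono fun l hl => Set.mem_iUnion.2 ⟨1, hΛ.1 hl, fun i => ?_⟩
  rw [hΛ.2 i]
  exact Ideal.subset_span ⟨l, hΛ.1 hl, hl, rfl⟩

/-- On a chart, the sections of the ideal sheaf of a linear subspace are dehomogenizations of forms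
in the ideal of its linear equations. -/
lemma exists_eq_dehom_of_mem_linear {Λ : ClosedSubscheme k r} {L : Submodule k (CoordRing k r)}
    (hΛ : IsLinearSubspace Λ L) {i : Fin (r + 1)} {s : Γ(ProjSpace k r, (chart k r i).1)}
    (hs : s ∈ Λ.ideal (chart k r i)) :
    ∃ d f, ∃ hf : f ∈ grading k r d, f ∈ linearIdeal L ∧ s = dehom i d f hf := by
  rw [hΛ.2 i] at hs
  refine Submodule.span_induction ?_ ?_ ?_ ?_ hs
  · rintro _ ⟨l, hl, hlL, rfl⟩
    exact ⟨1, l, hl, Ideal.subset_span hlL, rfl⟩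
  · exact ⟨0, 0, zero_mem _, zero_mem _, (dehom_zero i 0).symm⟩
  · rintro _ _ _ _ ⟨d, f, hf, hfL, rfl⟩ ⟨e, g, hg, hgL, rfl⟩
    exact ⟨d + e, _, X_pow_mul_add_mem_grading i hf hg,
      add_mem (Ideal.mul_mem_left _ _ hfL) (Ideal.mul_mem_left _ _ hgL),
      dehom_add_dehom i hf hg⟩
  · rintro t _ _ ⟨d, f, hf, hfL, rfl⟩
    obtain ⟨e, g, hg, rfl⟩ := exists_eq_dehom i t
    exact ⟨e + d, g * f, SetLike.mul_mem_graded hg hf, Ideal.mul_mem_left _ _ hfL,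
      (dehom_mul i hg hf).symm⟩

/-- A form that vanishes on `X ∩ Λ` lies, after multiplication by powers of the variables, in the
sum of the ideals of `X` and `Λ`. -/
lemma exists_pow_mul_mem_of_mem_formsVanishingOn {Z Λ : ClosedSubscheme k r}
    {L : Submodule k (CoordRing k r)} (hΛ : IsLinearSubspace Λ L) {d : ℕ} {f : CoordRing k r}
    (hf : f ∈ formsVanishingOn (inter Z Λ) d) (i : Fin (r + 1)) :
    ∃ N, X i ^ N * f ∈ homogIdeal Z ⊔ linearIdeal L := by
  obtain ⟨hfd, hf⟩ := hf
  have hfi : dehom i d f hfd ∈ Z.ideal (chart k r i) ⊔ Λ.ideal (chart k r i) := hf i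
  obtain ⟨a, ha, b, hb, hab⟩ := Submodule.mem_sup.1 hfi
  obtain ⟨m, g, hg, hgZ, rfl⟩ := exists_eq_dehom_of_mem Z ha
  obtain ⟨n, h, hh, hhL, rfl⟩ := exists_eq_dehom_of_mem_linear hΛ hb
  rw [dehom_add_dehom i hg hh, dehom_eq_dehom_iff] at hab
  refine ⟨m + n, ?_⟩
  rw [← hab]
  exact Ideal.mul_mem_left _ _ (add_mem
    (Ideal.mem_sup_left (Ideal.mul_mem_left _ _ (Ideal.subset_span (Set.mem_iUnion.2 ⟨m, hgZ⟩))))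
    (Ideal.mem_sup_right (Ideal.mul_mem_left _ _ hhL)))

lemma irrelevant_eq_linearIdeal :
    (HomogeneousIdeal.irrelevant (grading k r)).toIdeal = linearIdeal (grading k r 1) := by
  ext f
  rw [mem_linearIdeal_grading_one_iff, HomogeneousIdeal.mem_iff, HomogeneousIdeal.mem_irrelevant_iff,
    GradedRing.proj_apply, coe_decompose_eq_homogeneousComponent, homogeneousComponent_zero_eq,
    map_eq_zero_iff C (C_injective _ _)]

/-- A point of `ℙ^r` whose prime ideal contains the ideals of `Z` and `Λ` lies on `Z ∩ Λ`. -/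
lemma mem_support_inter_of_le {Z Λ : ClosedSubscheme k r}
    {L : Submodule k (CoordRing k r)} (hΛ : IsLinearSubspace Λ L) {q : ProjSpace k r}
    (hq : homogIdeal Z ⊔ linearIdeal L ≤ q.asHomogeneousIdeal.toIdeal) :
    q ∈ (inter Z Λ).support := by
  obtain ⟨i, hi⟩ : ∃ i, q ∈ (chart k r i).1 := by
    by_contra! h
    refine ProjectiveSpectrum.not_irrelevant_le q ?_
    change (HomogeneousIdeal.irrelevant (grading k r)).toIdeal ≤ q.asHomogeneousIdeal.toIdeal
    rw [irrelevant_eq_linearIdeal]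
    exact linearIdeal_grading_one_le fun i => not_not.1 (h i)
  rw [Scheme.IdealSheafData.mem_support_iff_of_mem hi, Scheme.mem_zeroLocus_iff]
  intro s hs
  have hs' : s ∈ Z.ideal (chart k r i) ⊔ Λ.ideal (chart k r i) := hs
  obtain ⟨a, ha, b, hb, rfl⟩ := Submodule.mem_sup.1 hs'
  obtain ⟨m, g, hg, hgZ, rfl⟩ := exists_eq_dehom_of_mem Z ha
  obtain ⟨n, h, hh, hhL, rfl⟩ := exists_eq_dehom_of_mem_linear hΛ hb
  rw [dehom_add_dehom i hg hh, mem_basicOpen_dehom _ _ _ _ q hi, not_not]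
  refine hq (add_mem (Ideal.mem_sup_left (Ideal.mul_mem_left _ _ (Ideal.subset_span ?_)))
    (Ideal.mem_sup_right (Ideal.mul_mem_left _ _ hhL)))
  exact Set.mem_iUnion.2 ⟨m, hgZ⟩

end Sheaf

/-! ### Zero-dimensional intersections and minimal resolutions -/

section Dimension

lemma eq_of_specializes_of_topologicalKrullDim_nonpos {T : Type*} [TopologicalSpace T] [T0Space T]
    {Y : Set T} (hY : topologicalKrullDim Y ≤ 0) {x y : T} (hx : x ∈ Y) (hy : y ∈ Y)
    (hxy : x ⤳ y) : x = y := by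
  let a : TopologicalSpace.IrreducibleCloseds Y :=
    ⟨closure {⟨x, hx⟩}, isIrreducible_singleton.closure, isClosed_closure⟩
  let b : TopologicalSpace.IrreducibleCloseds Y :=
    ⟨closure {⟨y, hy⟩}, isIrreducible_singleton.closure, isClosed_closure⟩
  have hsp : (⟨x, hx⟩ : Y) ⤳ ⟨y, hy⟩ := Topology.IsInducing.subtypeVal.specializes_iff.1 hxy
  have hba : b ≤ a := hsp.closure_subset
  have hab : a ≤ b := Order.krullDim_nonpos_iff_forall_isMax.1 hY b hba
  have hmem : (⟨x, hx⟩ : Y) ∈ closure {(⟨y, hy⟩ : Y)} := hab (subset_closure rfl)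
  exact congrArg Subtype.val (hsp.antisymm (specializes_iff_mem_closure.2 hmem)).eq

variable {k : Type u} [Field k] {r : ℕ}

/-- A homogeneous prime ideal that does not contain all variables is a point of `ℙ^r`. -/
noncomputable def pointOfPrime (P : HomogeneousIdeal (grading k r)) (hP : P.toIdeal.IsPrime)
    (hrel : ¬ linearIdeal (grading k r 1) ≤ P.toIdeal) : ProjSpace k r :=
  show ProjectiveSpectrum (grading k r) from
    ⟨P, hP, fun h => hrel (irrelevant_eq_linearIdeal.symm.trans_le h)⟩

lemma isHomogeneous_of_mem_minimalPrimes {J P : Ideal (CoordRing k r)}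
    (hJ : J.IsHomogeneous (grading k r)) (hP : P ∈ J.minimalPrimes) :
    P.IsHomogeneous (grading k r) := by
  have hcore : (P.homogeneousCore (grading k r)).toIdeal.IsPrime := hP.1.1.homogeneousCore
  have hle : J ≤ (P.homogeneousCore (grading k r)).toIdeal :=
    hJ.toIdeal_homogeneousCore_eq_self.symm.trans_le (Ideal.homogeneousCore_mono _ hP.1.2)
  have := hP.2 ⟨hcore, hle⟩ (Ideal.toIdeal_homogeneousCore_le _ P)
  rw [le_antisymm this (Ideal.toIdeal_homogeneousCore_le _ P)]
  exact (P.homogeneousCore (grading k r)).isHomogeneous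

/-- If `V(J)` is at most zero-dimensional in `ℙ^r`, a general linear form misses it: modulo `J` and
that linear form, all variables are nilpotent. -/
lemma exists_linear_form_nilpotent [Infinite k] {J : Ideal (CoordRing k r)}
    (hJ : J.IsHomogeneous (grading k r)) {Y : Set (ProjSpace k r)}
    (hY : topologicalKrullDim Y ≤ 0)
    (hJY : ∀ q : ProjSpace k r, J ≤ q.asHomogeneousIdeal.toIdeal → q ∈ Y)
    {L : Submodule k (CoordRing k r)} (hL : ¬ grading k r 1 ≤ L) :
    ∃ y ∈ grading k r 1, y ∉ L ∧
      ∀ l ∈ grading k r 1, ∃ N, l ^ N ∈ J ⊔ Ideal.span {y} := by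
  -- `y` avoids `L` and the minimal primes of `J` other than the irrelevant ideal
  obtain ⟨y, hy, hyL, hyP⟩ : ∃ y ∈ grading k r 1, y ∉ L ∧
      ∀ P ∈ J.minimalPrimes, ¬ linearIdeal (grading k r 1) ≤ P → y ∉ P := by
    by_contra! hcon
    let T := {P : Ideal (CoordRing k r) // P ∈ J.minimalPrimes ∧
      ¬ linearIdeal (grading k r 1) ≤ P}
    have : Finite T :=
      ((J.finite_minimalPrimes_of_isNoetherianRing).subset fun _ h => h.1).to_subtype
    let V : Option T → Submodule k (grading k r 1) := fun o =>
      (o.elim L fun P => P.1.restrictScalars k).comap (grading k r 1).subtype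
    obtain ⟨o, ho⟩ := Subspace.exists_eq_top_of_iUnion_eq_univ (p := V) (by
      refine Set.eq_univ_of_forall fun y => Set.mem_iUnion.2 ?_
      by_cases hyL : (y : CoordRing k r) ∈ L
      · exact ⟨none, hyL⟩
      · obtain ⟨P, hP, hP', hyP⟩ := hcon y y.2 hyL
        exact ⟨some ⟨P, hP, hP'⟩, hyP⟩)
    have hmem : ∀ y : grading k r 1, y ∈ V o := fun y => ho ▸ Submodule.mem_top
    cases o with
    | none => exact hL fun y hy => hmem ⟨y, hy⟩
    | some P => exact P.2.2 (Ideal.span_le.2 fun y hy => hmem ⟨y, hy⟩)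
  refine ⟨y, hy, hyL, fun l hl => ?_⟩
  change l ∈ (J ⊔ Ideal.span {y}).radical
  rw [Ideal.radical_eq_sInf, Submodule.mem_sInf]
  rintro Q ⟨hJQ, hQ⟩
  -- the homogeneous core of `Q` is again a prime over `J + (y)`, but need not be a point of `ℙ^r`
  have hJyhom : (J ⊔ Ideal.span {y}).IsHomogeneous (grading k r) :=
    hJ.sup (isHomogeneous_span_of_forall fun f hf => ⟨1, by
      rw [Set.mem_singleton_iff.1 hf]
      exact hy⟩)
  let Q' := Ideal.homogeneousCore (grading k r) Q
  have hQ' : Q'.toIdeal.IsPrime := hQ.homogeneousCore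
  have hJQ' : J ⊔ Ideal.span {y} ≤ Q'.toIdeal :=
    hJyhom.toIdeal_homogeneousCore_eq_self.symm.trans_le (Ideal.homogeneousCore_mono _ hJQ)
  by_cases hrel : linearIdeal (grading k r 1) ≤ Q'.toIdeal
  · exact Ideal.toIdeal_homogeneousCore_le _ Q (hrel (Ideal.subset_span hl))
  exfalso
  obtain ⟨P, hP, hPQ⟩ := Ideal.exists_minimalPrimes_le (le_sup_left.trans hJQ')
  have hrelP : ¬ linearIdeal (grading k r 1) ≤ P := fun h => hrel (h.trans hPQ)
  -- the points of `P` and `Q'` form a chain in `Y`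
  let x := pointOfPrime ⟨P, isHomogeneous_of_mem_minimalPrimes hJ hP⟩ hP.1.1 hrelP
  let z := pointOfPrime Q' hQ' hrel
  have hxz : x ⤳ z := specializes_iff_mem_closure.2
    ((ProjectiveSpectrum.le_iff_mem_closure (grading k r) x z).1 hPQ)
  have heq : x = z := eq_of_specializes_of_topologicalKrullDim_nonpos hY
    (hJY x hP.1.2) (hJY z (le_sup_left.trans hJQ')) hxz
  have hPQ' : P = Q'.toIdeal :=
    congrArg (fun q : ProjSpace k r => q.asHomogeneousIdeal.toIdeal) heq
  exact hyP P hP hrelP (hPQ' ▸ hJQ' (Ideal.mem_sup_right (Ideal.mem_span_singleton_self y)))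

end Dimension

section Quadrics

variable {k : Type u} [Field k] {r : ℕ}

/-- Modulo `𝔪 I`, the elements of an ideal `I` generated by quadrics are quadratic forms. -/
lemma exists_quadric_sub_mem_mul {I : Ideal (CoordRing k r)} {f : CoordRing k r}
    (hf : f ∈ Ideal.span {q | q ∈ I ∧ q.IsHomogeneous 2}) :
    ∃ q ∈ grading k r 2, f - q ∈ linearIdeal (grading k r 1) * I := by
  refine Submodule.span_induction ?_ ?_ ?_ ?_ hf
  · rintro q ⟨-, hq⟩
    exact ⟨q, hq, by simp⟩
  · exact ⟨0, zero_mem _, by simp⟩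
  · rintro f g _ _ ⟨p, hp, hp'⟩ ⟨q, hq, hq'⟩
    refine ⟨p + q, add_mem hp hq, ?_⟩
    rw [add_sub_add_comm]
    exact add_mem hp' hq'
  · rintro a f hf' ⟨q, hq, hq'⟩
    have hfI : f ∈ I := Ideal.span_le.2 (fun q hq => hq.1) hf'
    refine ⟨constantCoeff a • q, Submodule.smul_mem _ _ hq, ?_⟩
    have : a • f - constantCoeff a • q =
        (a - C (constantCoeff a)) * f + C (constantCoeff a) * (f - q) := by
      rw [smul_eq_C_mul, smul_eq_mul]
      ring
    rw [this]
    exact add_mem (Ideal.mul_mem_mul (mem_linearIdeal_grading_one_iff.2 (by simp)) hfI)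
      (Ideal.mul_mem_left _ _ hq')

lemma MinimalGradedFreeResolution.ε_mem {I : Ideal (CoordRing k r)}
    (R : MinimalGradedFreeResolution I) (j : Fin (R.rank 0)) : R.ε j ∈ I :=
  R.span_ε.le (Ideal.subset_span ⟨j, rfl⟩)

/-- If an ideal is generated by quadrics, then so is the first term of its minimal resolution: a
generator of another degree would lie in `𝔪 I`, against minimality. -/
lemma MinimalGradedFreeResolution.isHomogeneous_two_ε {I : Ideal (CoordRing k r)}
    (R : MinimalGradedFreeResolution I)
    (hI : I = Ideal.span {q | q ∈ I ∧ q.IsHomogeneous 2}) (j : Fin (R.rank 0)) :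
    (R.ε j).IsHomogeneous 2 := by
  by_cases hdeg : R.deg 0 j = 2
  · exact hdeg ▸ R.ε_homogeneous j
  exfalso
  have hεI := R.ε_mem j
  have hIhom : I.IsHomogeneous (grading k r) := by
    rw [hI]
    exact isHomogeneous_span_of_forall fun q hq => ⟨2, hq.2⟩
  obtain ⟨q, hq, hεq⟩ := exists_quadric_sub_mem_mul (hI.le hεI)
  have hε : R.ε j ∈ linearIdeal (grading k r 1) * I := by
    have := homogeneousComponent_mem_of_mem
      ((linearIdeal_isHomogeneous le_rfl).mul hIhom) hεq (R.deg 0 j)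
    rwa [map_sub, homogeneousComponent_eq_self (R.ε_homogeneous j),
      homogeneousComponent_of_mem hq, if_neg hdeg, sub_zero] at this
  obtain ⟨u, hu, huε⟩ : ∃ u : Fin (R.rank 0) → CoordRing k r,
      (∀ i, constantCoeff (u i) = 0) ∧ ∑ i, u i * R.ε i = R.ε j := by
    have hε' : R.ε j ∈ linearIdeal (grading k r 1) • Ideal.span (Set.range R.ε) := by
      rwa [R.span_ε]
    obtain ⟨u, hu, huε⟩ := (Submodule.mem_ideal_smul_span_iff_exists_sum _ _ _).1 hε'
    refine ⟨u, fun i => mem_linearIdeal_grading_one_iff.1 (hu i), ?_⟩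
    rw [← huε]
    exact (Finsupp.sum_fintype u (fun i c => c • R.ε i) fun i => zero_smul _ _).symm
  obtain ⟨w, hw⟩ := (R.exact_zero (Pi.single j 1 - u)).1 (by
    simp [sub_mul, Finset.sum_sub_distrib, huε, Pi.single_apply])
  -- the relation `e_j - u` has a unit entry, whereas all entries of `φ 0` are in `𝔪`
  have h1 := congrArg constantCoeff (congrFun hw j)
  simp [Matrix.mulVec, dotProduct, R.minimal, hu] at h1

end Quadrics

section Restriction

variable {k : Type u} [Field k] {r : ℕ}

/-- The ranks in the resolution of `S / I` obtained from a resolution of `I`. -/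
def MinimalGradedFreeResolution.augRank {I : Ideal (CoordRing k r)}
    (R : MinimalGradedFreeResolution I) : ℕ → ℕ
  | 0 => 1
  | t + 1 => R.rank t

/-- The differentials in the resolution `⋯ → F₁ → F₀ → S` of `S / I` obtained from a resolution
`⋯ → F₁ → F₀` of `I`. -/
def MinimalGradedFreeResolution.augDiff {I : Ideal (CoordRing k r)}
    (R : MinimalGradedFreeResolution I) :
    ∀ t, Matrix (Fin (R.augRank t)) (Fin (R.augRank (t + 1))) (CoordRing k r)
  | 0 => Matrix.of fun _ j => R.ε j
  | t + 1 => R.φ t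

lemma MinimalGradedFreeResolution.augDiff_zero_mulVec {I : Ideal (CoordRing k r)}
    (R : MinimalGradedFreeResolution I) (w : Fin (R.rank 0) → CoordRing k r)
    (i : Fin (R.augRank 0)) : (R.augDiff 0).mulVec w i = ∑ j, R.ε j * w j := rfl

lemma MinimalGradedFreeResolution.augDiff_exact {I : Ideal (CoordRing k r)}
    (R : MinimalGradedFreeResolution I) (t : ℕ) (v : Fin (R.augRank (t + 1)) → CoordRing k r) :
    (R.augDiff t).mulVec v = 0 ↔ ∃ w, (R.augDiff (t + 1)).mulVec w = v := by
  cases t with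
  | zero =>
    refine Iff.trans ?_ (R.exact_zero v)
    have hv : ∀ i, (R.augDiff 0).mulVec v i = ∑ j : Fin (R.rank 0), v j * R.ε j := fun i =>
      (R.augDiff_zero_mulVec v i).trans (Finset.sum_congr rfl fun j _ => mul_comm _ _)
    exact ⟨fun h => (hv (0 : Fin 1)).symm.trans (congrFun h (0 : Fin 1)),
      fun h => funext fun i => (hv i).trans h⟩
  | succ t => exact R.exact_succ t v

lemma MinimalGradedFreeResolution.exists_augDiff_zero_mulVec {I : Ideal (CoordRing k r)}
    (R : MinimalGradedFreeResolution I) {a : CoordRing k r} (ha : a ∈ I) :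
    ∃ w : Fin (R.rank 0) → CoordRing k r, ∑ j, R.ε j * w j = a := by
  rw [← R.span_ε, Ideal.mem_span_range_iff_exists_fun] at ha
  obtain ⟨w, hw⟩ := ha
  exact ⟨w, by rw [← hw]; exact Finset.sum_congr rfl fun j _ => mul_comm _ _⟩

/-- A quadratic form that is torsion modulo `I + (L)` lies in `I + (L)`, if `I` is generated by
quadrics, its resolution is linear up to step `dim V(L)`, and some linear form `y ∉ L` makes
`I + (L, y)` primary to the irrelevant ideal. -/
lemma exists_quadric_sub_mem {I : Ideal (CoordRing k r)} (R : MinimalGradedFreeResolution I)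
    (hI : I = Ideal.span {q | q ∈ I ∧ q.IsHomogeneous 2}) {q : ℕ}
    (hlin : ∀ s, s + 1 ≤ q → ∀ i j, (R.φ s i j).IsHomogeneous 1)
    {L : Submodule k (CoordRing k r)} (hL : L ≤ grading k r 1)
    (hdim : linearDim L ≤ q) {y : CoordRing k r} (hy : y ∈ grading k r 1) (hyL : y ∉ L)
    (hnil : ∀ l ∈ grading k r 1, ∃ N, l ^ N ∈ I ⊔ linearIdeal (L ⊔ Submodule.span k {y}))
    {f : CoordRing k r} (hf : f ∈ grading k r 2) {N : ℕ}
    (hfN : y ^ N * f ∈ I ⊔ linearIdeal L) :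
    ∃ g ∈ I, g ∈ grading k r 2 ∧ f - g ∈ linearIdeal L := by
  have hε := R.isHomogeneous_two_ε hI
  have hle : L ⊔ Submodule.span k {y} ≤ grading k r 1 :=
    sup_le hL ((Submodule.span_singleton_le_iff_mem _ _).2 hy)
  have hrank : Module.finrank k ↥(L ⊔ Submodule.span k {y}) = Module.finrank k L + 1 :=
    finrank_sup_span_singleton_of_le hL hyL
  have hrank' := Submodule.finrank_mono hle
  rw [finrank_grading_one] at hrank'
  have htor : TorVanishes R.augDiff (L ⊔ Submodule.span k {y}) 0 :=
    torVanishes_of_codim R.augDiff_exact (I := I)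
      (fun a ha v => by
        obtain ⟨w, hw⟩ := R.exists_augDiff_zero_mulVec (I.mul_mem_right (v (0 : Fin 1)) ha)
        refine ⟨w, funext fun i => ?_⟩
        rw [R.augDiff_zero_mulVec, hw, show i = (0 : Fin 1) from Subsingleton.elim (α := Fin 1) _ _]
        rfl)
      hlin (r - Module.finrank k L) _ hle (by omega) hnil 0 (by
        rw [linearDim] at hdim
        omega)
  obtain ⟨a, ha, b, hb, hab⟩ := Submodule.mem_sup.1 hfN
  obtain ⟨w, hw⟩ := R.exists_augDiff_zero_mulVec ha
  obtain ⟨w', hw'⟩ := exists_sub_mulVec_mem_of_pow_mul (D := R.augDiff) (t := 0) (m := 1)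
    (fun t w => (R.augDiff_exact t _).2 ⟨w, rfl⟩) hL hy hyL (fun _ j => hε j) htor
    (v := fun _ => f)
    (fun _ m hm => by rw [homogeneousComponent_of_mem hf, if_neg (by omega)]) N (w := w)
    (fun i => by rwa [R.augDiff_zero_mulVec, hw, ← hab, add_sub_cancel_left])
  refine ⟨∑ j, R.ε j * C (constantCoeff (w' j)), ?_, ?_, ?_⟩
  · refine Ideal.sum_mem _ fun j _ => Ideal.mul_mem_right _ _ (R.ε_mem j)
  · rw [← homogeneousComponent_sum_mul hε w']
    exact homogeneousComponent_mem _ _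
  · have hfw : f - ∑ j, R.ε j * w' j ∈ linearIdeal L := hw' (0 : Fin 1)
    have := homogeneousComponent_mem_of_mem (linearIdeal_isHomogeneous hL) hfw 2
    rwa [map_sub, homogeneousComponent_sum_mul hε w',
      homogeneousComponent_eq_self ((mem_homogeneousSubmodule _ _).1 hf)] at this

/-- A quadratic form that vanishes on `Z ∩ Λ` is congruent, modulo the equations of `Λ`, to one that
vanishes on `Z`. -/
lemma exists_quadric_vanishing_sub_mem [Infinite k] {p : ℕ} (hp : 1 ≤ p)
    {Z Λ : ClosedSubscheme k r} (hZ : SatisfiesN2 Z p)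
    {L : Submodule k (CoordRing k r)} (hΛ : IsLinearSubspace Λ L)
    (hdim : linearDim L ≤ (p : ℤ) - 1) (hzero : dim (inter Z Λ) ≤ 0) {f : CoordRing k r}
    (hf : f ∈ formsVanishingOn (inter Z Λ) 2) :
    ∃ g ∈ formsVanishingOn Z 2, f - g ∈ linearIdeal L := by
  have hf2 : f ∈ grading k r 2 := hf.1
  by_cases hLtop : grading k r 1 ≤ L
  -- `Λ` is empty
  · refine ⟨0, zero_mem _, ?_⟩
    rw [sub_zero]
    refine Ideal.span_mono hLtop (mem_linearIdeal_grading_one_iff.2 ?_)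
    rw [constantCoeff_eq]
    exact ((mem_homogeneousSubmodule _ _).1 hf2).coeff_eq_zero (by simp)
  obtain ⟨-, hgen, R, hlin⟩ := hZ
  obtain ⟨y, hy, hyL, hnil⟩ := exists_linear_form_nilpotent
    ((homogIdeal_isHomogeneous Z).sup (linearIdeal_isHomogeneous hΛ.1)) hzero
    (fun q hq => mem_support_inter_of_le hΛ hq) hLtop
  have hyf : ∃ N, y ^ N * f ∈ homogIdeal Z ⊔ linearIdeal L := by
    have : linearIdeal (grading k r 1) ≤
        ((homogIdeal Z ⊔ linearIdeal L).colon {f}).radical :=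
      linearIdeal_grading_one_le fun i => by
        obtain ⟨N, hN⟩ := exists_pow_mul_mem_of_mem_formsVanishingOn hΛ hf i
        exact ⟨N, Submodule.mem_colon_singleton.2 hN⟩
    obtain ⟨N, hN⟩ := this (Ideal.subset_span hy)
    exact ⟨N, Submodule.mem_colon_singleton.1 hN⟩
  obtain ⟨N, hN⟩ := hyf
  obtain ⟨g, hgI, hg2, hfg⟩ := exists_quadric_sub_mem R hgen hlin hΛ.1 (by omega) hy hyL
    (by simpa only [linearIdeal_sup_span_singleton, ← sup_assoc] using hnil) hf2 hN
  exact ⟨g, mem_formsVanishingOn_of_mem_homogIdeal hgI hg2, hfg⟩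

end Restriction

end RestrictSyz

theorem theorem1p2 {k : Type u} [Field k] [IsAlgClosed k] (r p : ℕ) (hp : 1 ≤ p)
    (X Λ : RestrictSyz.ClosedSubscheme k r) (hX : RestrictSyz.SatisfiesN2 X p)
    (L : Submodule k (RestrictSyz.CoordRing k r)) (hΛ : RestrictSyz.IsLinearSubspace Λ L)
    (hdim : RestrictSyz.linearDim L ≤ (p : ℤ) - 1)
    (hzero : RestrictSyz.dim (RestrictSyz.inter X Λ) ≤ 0) :
    Function.Surjective (RestrictSyz.restrictForms X Λ 2) := by
  rintro ⟨_, f, hf, rfl⟩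
  obtain ⟨g, hg, hfg⟩ := RestrictSyz.exists_quadric_vanishing_sub_mem hp hX hΛ hdim hzero hf
  refine ⟨⟨g, hg⟩, Subtype.ext ?_⟩
  exact (Ideal.Quotient.eq.2 (RestrictSyz.linearIdeal_le_homogIdeal hΛ hfg)).symm
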